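/- Let $M$ be a finite nonempty set of modes, $n\in\mathbb{N}$, and for every $m\in M$ let $\mathcal{R}(m)\subseteq\mathbb{R}^n$ be a convex polytope, i.e. a bounded set of the form $\{x : Ax\le b\}$ for some real matrix $A$ with finitely many rows and some real vector $b$; thus $(M,n,\mathcal{R})$ is a bounded-rate multi-mode system. Let the safety set $S\subseteq\mathbb{R}^n$ be a convex polytope as well. In the schedulability game from a starting state $x_0\in\mathbb{R}^n$, in round $i=1,2,\dots$ the scheduler chooses a timed move $(m_i,t_i)\in M\times\mathbb{R}_{\ge 0}$, then the environment chooses a rate $r_i\in\mathcal{R}(m_i)$, and the state becomes $x_i=x_{i-1}+t_i r_i$. The scheduler wins the resulting infinite run if $x_{i-1}+t\,r_i\in S$ for all $i\ge1$ and $t\in[0,t_i]$, and $\sum_{i\ge 1} t_i=\infty$; otherwise the environment wins it. A strategy of the scheduler is a function that assigns a timed move to every finite run $\langle x_0,(m_1,t_1),r_1,x_1,\dots,(m_k,t_k),r_k,x_k\rangle$; a strategy of the environment is a function that assigns to every finite run and every timed move $(m,t)$ a rate in $\mathcal{R}(m)$. A strategy is positional if its value depends on the finite run only through the last state $x_k$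 (for the environment: only on $x_k$ and the timed move $(m,t)$). A strategy of a player is winning from $x_0$ if that player wins the run from $x_0$ against every strategy of the opponent. Theorem. Schedulability games on bounded-rate multi-mode systems with convex polytope safety sets are positionally determined: for every starting state $x_0\in\mathbb{R}^n$, exactly one of the two players has a winning strategy from $x_0$, and that player has a positional winning strategy from $x_0$. -/

import Mathlib

open scoped NNReal Matrix

/-- A bounded set of points of Euclidean space that is the solution set of a finite system of
linear inequalities `A x ≤ b`. -/
def IsConvexPolytope {n : ℕ} (P : Set (EuclideanSpace ℝ (Fin n))) : Prop :=
  Bornology.IsBounded P ∧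
    ∃ (k : ℕ) (A : Matrix (Fin k) (Fin n) ℝ) (b : Fin k → ℝ),
      ∀ x : EuclideanSpace ℝ (Fin n), x ∈ P ↔ A *ᵥ x.ofLp ≤ b

/-- A multi-mode system with modes `M` and `n` real variables: every mode has a set of allowable
rate vectors. -/
structure MultiModeSystem (M : Type*) (n : ℕ) where
  rates : M → Set (EuclideanSpace ℝ (Fin n))

namespace MultiModeSystem

/-- Bounded-rate multi-mode systems: the rates of each mode form a convex polytope. -/
def IsBoundedRate {M : Type*} {n : ℕ} (H : MultiModeSystem M n) : Prop :=
  ∀ m, IsConvexPolytope (H.rates m)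

/-- Finite runs `⟨x₀, (m₁, t₁), r₁, x₁, …, (m_k, t_k), r_k, x_k⟩`. The states `x₁, …, x_k` are
determined by the other data, see `FiniteRun.last`. -/
inductive FiniteRun {M : Type*} {n : ℕ} (H : MultiModeSystem M n) where
  | start (x₀ : EuclideanSpace ℝ (Fin n)) : FiniteRun H
  | extend (ρ : FiniteRun H) (a : M × ℝ≥0) (r : H.rates a.1) : FiniteRun H

/-- The last state of a finite run. -/
def FiniteRun.last {M : Type*} {n : ℕ} {H : MultiModeSystem M n} :
    FiniteRun H → EuclideanSpace ℝ (Fin n)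
  | .start x₀ => x₀
  | .extend ρ a r => ρ.last + (a.2 : ℝ) • (r : EuclideanSpace ℝ (Fin n))

/-- Infinite runs `⟨x₀, (m₁, t₁), r₁, x₁, (m₂, t₂), r₂, …⟩`; here `move i` is `(m_{i+1}, t_{i+1})`
and `rate i` is `r_{i+1}`. -/
structure InfiniteRun {M : Type*} {n : ℕ} (H : MultiModeSystem M n) where
  state : ℕ → EuclideanSpace ℝ (Fin n)
  move : ℕ → M × ℝ≥0
  rate : (i : ℕ) → H.rates (move i).1
  state_succ : ∀ i, state (i + 1) =
    state i + ((move i).2 : ℝ) • (rate i : EuclideanSpace ℝ (Fin n))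

/-- A run is Zeno if its total duration is finite. -/
def InfiniteRun.IsZeno {M : Type*} {n : ℕ} {H : MultiModeSystem M n} (ρ : InfiniteRun H) : Prop :=
  Summable fun i => (ρ.move i).2

/-- A run is `S`-safe if the system is in `S` at all times. -/
def InfiniteRun.IsSafe {M : Type*} {n : ℕ} {H : MultiModeSystem M n} (ρ : InfiniteRun H)
    (S : Set (EuclideanSpace ℝ (Fin n))) : Prop :=
  ∀ i, ρ.state i ∈ S ∧ ∀ t ∈ Set.Icc (0 : ℝ) (ρ.move i).2,
    ρ.state i + t • (ρ.rate i : EuclideanSpace ℝ (Fin n)) ∈ S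

/-- The safe schedulability objective: the `S`-safe non-Zeno runs. -/
def safeObjective {M : Type*} {n : ℕ} (H : MultiModeSystem M n)
    (S : Set (EuclideanSpace ℝ (Fin n))) : Set (InfiniteRun H) :=
  {ρ | ρ.IsSafe S ∧ ¬ ρ.IsZeno}

/-- A strategy of the scheduler gives a timed move for every history. -/
def SchedulerStrategy {M : Type*} {n : ℕ} (H : MultiModeSystem M n) :=
  FiniteRun H → M × ℝ≥0

/-- A strategy of the environment gives an allowable rate for every history and every timed move
of the scheduler. -/
def EnvironmentStrategy {M : Type*} {n : ℕ} (H : MultiModeSystem M n) :=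
  FiniteRun H → (a : M × ℝ≥0) → H.rates a.1

/-- The history after `i` rounds from `x₀`. -/
def history {M : Type*} {n : ℕ} {H : MultiModeSystem M n} (x₀ : EuclideanSpace ℝ (Fin n))
    (σ : SchedulerStrategy H) (π : EnvironmentStrategy H) : ℕ → FiniteRun H
  | 0 => .start x₀
  | i + 1 => .extend (history x₀ σ π i) (σ (history x₀ σ π i))
      (π (history x₀ σ π i) (σ (history x₀ σ π i)))

/-- The infinite run from `x₀` in which the players follow `σ` and `π`. -/
def run {M : Type*} {n : ℕ} {H : MultiModeSystem M n} (x₀ : EuclideanSpace ℝ (Fin n))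
    (σ : SchedulerStrategy H) (π : EnvironmentStrategy H) : InfiniteRun H where
  state i := (history x₀ σ π i).last
  move i := σ (history x₀ σ π i)
  rate i := π (history x₀ σ π i) (σ (history x₀ σ π i))
  state_succ _ := rfl

/-- A scheduler strategy is positional if it depends on the last state only. -/
def SchedulerStrategy.IsPositional {M : Type*} {n : ℕ} {H : MultiModeSystem M n}
    (σ : SchedulerStrategy H) : Prop :=
  ∀ ρ ρ' : FiniteRun H, ρ.last = ρ'.last → σ ρ = σ ρ'

/-- An environment strategy is positional if its answer to a timed move depends, apart from that
move, on the last state only. -/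
def EnvironmentStrategy.IsPositional {M : Type*} {n : ℕ} {H : MultiModeSystem M n}
    (π : EnvironmentStrategy H) : Prop :=
  ∀ ρ ρ' : FiniteRun H, ρ.last = ρ'.last → ∀ a, π ρ a = π ρ' a

/-- `σ` wins the schedulability game with safety set `S` from `x₀`. -/
def SchedulerStrategy.IsWinning {M : Type*} {n : ℕ} {H : MultiModeSystem M n}
    (σ : SchedulerStrategy H) (S : Set (EuclideanSpace ℝ (Fin n)))
    (x₀ : EuclideanSpace ℝ (Fin n)) : Prop :=
  ∀ π : EnvironmentStrategy H, run x₀ σ π ∈ H.safeObjective S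

/-- `π` wins the schedulability game with safety set `S` from `x₀`. -/
def EnvironmentStrategy.IsWinning {M : Type*} {n : ℕ} {H : MultiModeSystem M n}
    (π : EnvironmentStrategy H) (S : Set (EuclideanSpace ℝ (Fin n)))
    (x₀ : EuclideanSpace ℝ (Fin n)) : Prop :=
  ∀ σ : SchedulerStrategy H, run x₀ σ π ∉ H.safeObjective S

/-- The scheduler has a winning strategy from `x₀`. -/
def SchedulerWins {M : Type*} {n : ℕ} (H : MultiModeSystem M n)
    (S : Set (EuclideanSpace ℝ (Fin n))) (x₀ : EuclideanSpace ℝ (Fin n)) : Prop :=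
  ∃ σ : SchedulerStrategy H, σ.IsWinning S x₀

/-- The environment has a winning strategy from `x₀`. -/
def EnvironmentWins {M : Type*} {n : ℕ} (H : MultiModeSystem M n)
    (S : Set (EuclideanSpace ℝ (Fin n))) (x₀ : EuclideanSpace ℝ (Fin n)) : Prop :=
  ∃ π : EnvironmentStrategy H, π.IsWinning S x₀

end MultiModeSystem

/-! For `x₀` in `S`, the winner is decided by `CanOppose` on the sets `I` of constraints of `S` that
are tight at `x₀`. If it fails for some `I`, witnessed by `v`, every mode has a rate that either
breaks a constraint of `I` at once or stays in the face of `I` and strictly increases `v`. The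
environment always answers with that rate. On a safe run `v` then grows at least linearly in time,
and `S` is bounded, so the run is Zeno. If it holds for every such `I`, the scheduler opposes the
differential of the barrier `w` at the current state, with a duration proportional to `1 / w ^ 2`.
Such short moves keep slack constraints slack, so the tight set only shrinks and is eventually
constant. From then on the run stays in one face and `w ^ 2` grows by at most 2 per round
(`step_barrier_le`), so the durations dominate a harmonic series (`not_summable_of_sq_growth`). -/

namespace MultiModeSystem

/-- The constraints `ℓ i ≤ b i` that are tight at `x`. -/
noncomputable def activeSet {E : Type*} {k : ℕ} (l : Fin k → E → ℝ) (b : Fin k → ℝ) (x : E) : Finset (Fin k) :=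
  open Classical in Finset.univ.filter fun i => l i x = b i

/-- In a face with tight constraints `I`, the scheduler can oppose every linear functional `v`: some
mode respects the constraints `I`, and its rates that stay in the face do not increase `v`. -/
def CanOppose {M : Type*} {n k : ℕ} (H : MultiModeSystem M n)
    (l : Fin k → EuclideanSpace ℝ (Fin n) →L[ℝ] ℝ) (I : Finset (Fin k)) : Prop :=
  ∀ v : EuclideanSpace ℝ (Fin n) →L[ℝ] ℝ, ∃ m, (∀ r ∈ H.rates m, ∀ i ∈ I, l i r ≤ 0) ∧
    ∀ r ∈ H.rates m, (∀ i ∈ I, l i r = 0) → v r ≤ 0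

/-- The barrier function of a system of linear inequalities, in which tight constraints are
ignored because `0⁻¹ = 0`. -/
noncomputable def barrier {E : Type*} {k : ℕ} (l : Fin k → E → ℝ) (b : Fin k → ℝ) (x : E) : ℝ :=
  1 + ∑ i, (b i - l i x)⁻¹

/-! ### Estimates for the barrier -/

theorem mem_activeSet {E : Type*} {k : ℕ} {l : Fin k → E → ℝ} {b : Fin k → ℝ} {x : E}
    {i : Fin k} : i ∈ activeSet l b x ↔ l i x = b i := by
  simp [activeSet]

theorem one_le_barrier {E : Type*} {k : ℕ} {l : Fin k → E → ℝ} {b : Fin k → ℝ} {x : E}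
    (hx : ∀ i, l i x ≤ b i) : 1 ≤ barrier l b x := by
  have : 0 ≤ ∑ i, (b i - l i x)⁻¹ :=
    Finset.sum_nonneg fun i _ => inv_nonneg.2 (sub_nonneg.2 (hx i))
  unfold barrier
  linarith

theorem inv_slack_le_barrier {E : Type*} {k : ℕ} {l : Fin k → E → ℝ} {b : Fin k → ℝ} {x : E}
    (hx : ∀ i, l i x ≤ b i) (i : Fin k) : (b i - l i x)⁻¹ ≤ barrier l b x := by
  have : (b i - l i x)⁻¹ ≤ ∑ j, (b j - l j x)⁻¹ :=
    Finset.single_le_sum (f := fun j => (b j - l j x)⁻¹)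
      (fun j _ => inv_nonneg.2 (sub_nonneg.2 (hx j))) (Finset.mem_univ i)
  unfold barrier
  linarith

/-- This is why the scheduler's moves are safe: each uses up at most half of any positive slack. -/
theorem half_inv_sq_le {s w : ℝ} (hs : 0 < s) (hw : 1 ≤ w) (hsw : s⁻¹ ≤ w) :
    1 / (2 * w ^ 2) ≤ s / 2 := by
  have h1 : 1 ≤ s * w := by
    have := mul_le_mul_of_nonneg_left hsw hs.le
    rwa [mul_inv_cancel₀ hs.ne'] at this
  rw [div_le_div_iff₀ (by positivity) (by norm_num)]
  nlinarith [mul_le_mul h1 hw (by norm_num) (by positivity)]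

/-- With `q = e / s`, this is `(1 - q)⁻¹ ≤ 1 + q + 2 * q ^ 2` for `|q| ≤ 1 / 2`; the step bound
gives `|q| ≤ 1 / (2 * w)`. -/
theorem inv_sub_le {s w e : ℝ} (hs : 0 < s) (hw : 1 ≤ w) (hsw : s⁻¹ ≤ w)
    (he : |e| ≤ 1 / (2 * w ^ 2)) :
    (s - e)⁻¹ ≤ s⁻¹ + e * s⁻¹ ^ 2 + s⁻¹ * (1 / (2 * w ^ 2)) := by
  have hw0 : 0 < w := by linarith
  set y := s⁻¹ with hy
  have hy0 : 0 < y := inv_pos.2 hs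
  have hsy : s = y⁻¹ := by rw [hy, inv_inv]
  set q := e * y with hq
  have hqa : |q| ≤ 1 / (2 * w) := by
    rw [hq, abs_mul, abs_of_pos hy0]
    calc |e| * y ≤ 1 / (2 * w ^ 2) * w := mul_le_mul he hsw hy0.le (by positivity)
      _ = 1 / (2 * w) := by field_simp
  have hhalf : |q| ≤ 1 / 2 := hqa.trans (by
    apply one_div_le_one_div_of_le <;> linarith)
  have hq2 : 2 * q ^ 2 ≤ 1 / (2 * w ^ 2) := by
    have h := pow_le_pow_left₀ (abs_nonneg q) hqa 2
    rw [sq_abs] at h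
    have h' : (1 / (2 * w)) ^ 2 * 2 = 1 / (2 * w ^ 2) := by field_simp
    linarith
  have hq1 := abs_le.1 hhalf
  have h1q : 0 < 1 - q := by linarith
  have e1 : (s - e)⁻¹ = y * (1 - q)⁻¹ := by
    have h : s - e = s * (1 - q) := by
      rw [hq, hy]; field_simp
    rw [h, mul_inv]
  have e2 : (1 - q)⁻¹ ≤ 1 + q + 2 * q ^ 2 := by
    rw [inv_le_iff_one_le_mul₀ h1q]
    nlinarith [mul_nonneg (sq_nonneg q) (by linarith : (0 : ℝ) ≤ 1 - 2 * q)]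
  rw [e1]
  calc y * (1 - q)⁻¹ ≤ y * (1 + q + 1 / (2 * w ^ 2)) :=
        mul_le_mul_of_nonneg_left (by linarith) hy0.le
    _ = _ := by rw [hq]; ring

/-! ### One short move -/

section Step

variable {E : Type*} [NormedAddCommGroup E] [NormedSpace ℝ E] {k : ℕ} {l : Fin k → E →L[ℝ] ℝ}
  {b : Fin k → ℝ} {x r : E} {t : ℝ}

theorem step_slack_pos (hx : ∀ i, l i x ≤ b i)
    (hr : ∀ i, t * |l i r| ≤ 1 / (2 * barrier (fun i => l i) b x ^ 2))
    {i : Fin k} (hi : i ∉ activeSet (fun i => l i) b x) {t' : ℝ} (h0 : 0 ≤ t') (ht' : t' ≤ t) :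
    l i (x + t' • r) < b i := by
  rw [mem_activeSet] at hi
  have hs : 0 < b i - l i x := sub_pos.2 (lt_of_le_of_ne (hx i) hi)
  have h1 := half_inv_sq_le hs (one_le_barrier hx) (inv_slack_le_barrier hx i)
  have h2 : t' * l i r ≤ t * |l i r| :=
    (mul_le_mul_of_nonneg_left (le_abs_self _) h0).trans
      (mul_le_mul_of_nonneg_right ht' (abs_nonneg _))
  have h3 := hr i
  simp only [map_add, map_smul, smul_eq_mul]
  linarith

theorem step_safe (hx : ∀ i, l i x ≤ b i)
    (hr : ∀ i, t * |l i r| ≤ 1 / (2 * barrier (fun i => l i) b x ^ 2))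
    (hI : ∀ i ∈ activeSet (fun i => l i) b x, l i r ≤ 0) {t' : ℝ} (h0 : 0 ≤ t') (ht' : t' ≤ t)
    (i : Fin k) : l i (x + t' • r) ≤ b i := by
  by_cases hi : i ∈ activeSet (fun i => l i) b x
  · have := mul_nonpos_of_nonneg_of_nonpos h0 (hI i hi)
    have := mem_activeSet.1 hi
    simp only [map_add, map_smul, smul_eq_mul]
    linarith
  · exact (step_slack_pos hx hr hi h0 ht').le

theorem step_activeSet_subset (hx : ∀ i, l i x ≤ b i) (ht : 0 ≤ t)
    (hr : ∀ i, t * |l i r| ≤ 1 / (2 * barrier (fun i => l i) b x ^ 2)) :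
    activeSet (fun i => l i) b (x + t • r) ⊆ activeSet (fun i => l i) b x := by
  intro i hi
  by_contra h
  exact (step_slack_pos hx hr h ht le_rfl).ne (mem_activeSet.1 hi)

/-- The sum in `hv` is the derivative of the barrier along `r`, so only the second-order errors
remain, and they add up to at most `1 / (2 * w)`. -/
theorem step_barrier_le (hx : ∀ i, l i x ≤ b i) (ht : 0 ≤ t)
    (hr : ∀ i, t * |l i r| ≤ 1 / (2 * barrier (fun i => l i) b x ^ 2))
    (hI : ∀ i ∈ activeSet (fun i => l i) b x, l i r = 0)
    (hv : ∑ i, (b i - l i x)⁻¹ ^ 2 * l i r ≤ 0) :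
    barrier (fun i => l i) b (x + t • r) ^ 2 ≤ barrier (fun i => l i) b x ^ 2 + 2 := by
  set w := barrier (fun i => l i) b x with hw
  have hw1 : 1 ≤ w := one_le_barrier hx
  have hw0 : 0 < w := by linarith
  have hterm : ∀ i, (b i - l i (x + t • r))⁻¹ ≤
      (b i - l i x)⁻¹ + t * ((b i - l i x)⁻¹ ^ 2 * l i r) +
        (b i - l i x)⁻¹ * (1 / (2 * w ^ 2)) := by
    intro i
    have e : b i - l i (x + t • r) = (b i - l i x) - t * l i r := by
      simp only [map_add, map_smul, smul_eq_mul]; ring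
    rw [e]
    by_cases hi : i ∈ activeSet (fun i => l i) b x
    -- A tight constraint stays tight, and its terms vanish because `0⁻¹ = 0`.
    · have h1 : l i x = b i := mem_activeSet.1 hi
      simp [hI i hi, h1]
    · have hs : 0 < b i - l i x :=
        sub_pos.2 (lt_of_le_of_ne (hx i) fun h => hi (mem_activeSet.2 h))
      refine (inv_sub_le hs hw1 (inv_slack_le_barrier hx i) ?_).trans (le_of_eq ?_)
      · rw [abs_mul, abs_of_nonneg ht]; exact hr i
      · ring
  have hsum := Finset.sum_le_sum fun i (_ : i ∈ Finset.univ) => hterm i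
  rw [Finset.sum_add_distrib, Finset.sum_add_distrib, ← Finset.mul_sum, ← Finset.sum_mul] at hsum
  have hbar : ∑ i, (b i - l i x)⁻¹ = w - 1 := by rw [hw, barrier]; ring
  have h1 : barrier (fun i => l i) b (x + t • r) ≤ w + 1 / (2 * w) := by
    have h2 : (w - 1) * (1 / (2 * w ^ 2)) ≤ 1 / (2 * w) := by
      calc (w - 1) * (1 / (2 * w ^ 2)) ≤ w * (1 / (2 * w ^ 2)) :=
            mul_le_mul_of_nonneg_right (by linarith) (by positivity)
        _ = 1 / (2 * w) := by field_simp
    have h3 := mul_nonpos_of_nonneg_of_nonpos ht hv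
    rw [hbar] at hsum
    rw [barrier]
    linarith
  have h0 : 0 ≤ barrier (fun i => l i) b (x + t • r) := by
    refine zero_le_one.trans (one_le_barrier fun i => ?_)
    exact step_safe hx hr (fun i hi => (hI i hi).le) ht le_rfl i
  have h4 : 1 / (2 * w) ≤ 1 / 2 := one_div_le_one_div_of_le (by norm_num) (by linarith)
  have h5 : 0 ≤ 1 / (2 * w) := by positivity
  have h6 : w * (1 / (2 * w)) = 1 / 2 := by field_simp
  -- `(w + 1 / (2 * w)) ^ 2 = w ^ 2 + 1 + 1 / (4 * w ^ 2)`.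
  nlinarith [pow_le_pow_left₀ h0 h1 2]

end Step

/-! ### Divergence of the total time -/

theorem not_summable_of_sq_growth {w t : ℕ → ℝ} {B : ℝ} (hB : 0 < B) {N : ℕ}
    (hw : ∀ i, 1 ≤ w i) (ht : ∀ i, t i = 1 / (2 * w i ^ 2) / B)
    (hgrow : ∀ i, N ≤ i → w (i + 1) ^ 2 ≤ w i ^ 2 + 2) : ¬ Summable t := by
  intro hs
  -- Linear growth, put in product form by means of `1 ≤ w N` for comparison with `1 / (j + 1)`.
  have hbound : ∀ j, w (j + N) ^ 2 ≤ w N ^ 2 * 2 * (j + 1) := by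
    intro j
    induction j with
    | zero => simp only [zero_add, Nat.cast_zero]; nlinarith [sq_nonneg (w N)]
    | succ j ih =>
      have h := hgrow (j + N) (Nat.le_add_left _ _)
      have e : j + 1 + N = j + N + 1 := by ring
      rw [e]
      push_cast
      nlinarith [hw N]
  have hpos : ∀ j, 0 < w j := fun j => by linarith [hw j]
  have hs' := (summable_nat_add_iff N).2 hs
  have hs2 := hs'.mul_left (4 * w N ^ 2 * B)
  have hs3 : Summable fun j : ℕ => 1 / ((j : ℝ) + 1) := by
    refine Summable.of_nonneg_of_le (fun j => by positivity) (fun j => ?_) hs2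
    rw [ht]
    have h1 := hbound j
    have h2 := hpos (j + N)
    have e : 4 * w N ^ 2 * B * (1 / (2 * w (j + N) ^ 2) / B) = 2 * w N ^ 2 / w (j + N) ^ 2 := by
      field_simp; ring
    rw [e, div_le_div_iff₀ (by positivity) (by positivity)]
    linarith
  have := (summable_nat_add_iff (f := fun j : ℕ => 1 / (j : ℝ)) 1).1 (by simpa using hs3)
  exact Real.not_summable_one_div_natCast this

theorem eventually_const_of_antitone_finset {α : Type*} {I : ℕ → Finset α}
    (hI : ∀ i, I (i + 1) ⊆ I i) : ∃ N, ∀ i, N ≤ i → I (i + 1) = I i := by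
  have hanti : Antitone I := antitone_nat_of_succ_le hI
  let N := Function.argmin fun i => (I i).card
  have hN : ∀ i, N ≤ i → I i = I N := fun i hi =>
    Finset.eq_of_subset_of_card_le (hanti hi) (Function.argmin_le (fun i => (I i).card) i)
  exact ⟨N, fun i hi => (hN _ (hi.trans i.le_succ)).trans (hN i hi).symm⟩

/-! ### Positional strategies for the two players -/

section Game

variable {M : Type*} {n : ℕ} {H : MultiModeSystem M n}

theorem exists_positional_scheduler_of_canOppose {k : ℕ}
    {l : Fin k → EuclideanSpace ℝ (Fin n) →L[ℝ] ℝ} {b : Fin k → ℝ} {B : ℝ} (hB : 0 < B)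
    (hrates : ∀ m, ∀ r ∈ H.rates m, ∀ i, |l i r| ≤ B)
    {S : Set (EuclideanSpace ℝ (Fin n))} (hS : ∀ x, x ∈ S ↔ ∀ i, l i x ≤ b i)
    {x₀ : EuclideanSpace ℝ (Fin n)} (hx₀ : x₀ ∈ S)
    (hopp : ∀ I ⊆ activeSet (fun i => l i) b x₀, H.CanOppose l I) :
    ∃ σ : H.SchedulerStrategy, σ.IsPositional ∧ σ.IsWinning S x₀ := by
  classical
  obtain ⟨m₀, -⟩ := hopp ∅ (Finset.empty_subset _) 0
  have hex : ∀ x, ∃ m, H.CanOppose l (activeSet (fun i => l i) b x) →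
      (∀ r ∈ H.rates m, ∀ i ∈ activeSet (fun i => l i) b x, l i r ≤ 0) ∧
      ∀ r ∈ H.rates m, (∀ i ∈ activeSet (fun i => l i) b x, l i r = 0) →
        ∑ i, (b i - l i x)⁻¹ ^ 2 * l i r ≤ 0 := by
    intro x
    by_cases h : H.CanOppose l (activeSet (fun i => l i) b x)
    -- The functional opposed is the differential of the barrier, in which tight constraints have
    -- weight zero.
    · obtain ⟨m, h1, h2⟩ := h (∑ i, (b i - l i x)⁻¹ ^ 2 • l i)
      refine ⟨m, fun _ => ⟨h1, fun r hr hI => ?_⟩⟩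
      simpa using h2 r hr hI
    · exact ⟨m₀, fun h' => absurd h' h⟩
  choose mode hmode using hex
  let w : EuclideanSpace ℝ (Fin n) → ℝ := barrier (fun i => l i) b
  let σ : H.SchedulerStrategy := fun ρ =>
    (mode ρ.last, Real.toNNReal (1 / (2 * w ρ.last ^ 2) / B))
  refine ⟨σ, fun ρ ρ' h => by simp only [σ, h], fun π => ?_⟩
  set x : ℕ → EuclideanSpace ℝ (Fin n) := (run x₀ σ π).state with hxdef
  set t : ℕ → ℝ := fun i => (((run x₀ σ π).move i).2 : ℝ) with htdef
  have ht : ∀ i, t i = 1 / (2 * w (x i) ^ 2) / B := fun i =>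
    Real.coe_toNNReal _ (by positivity)
  have ht0 : ∀ i, 0 ≤ t i := fun i => NNReal.coe_nonneg _
  let r : ℕ → EuclideanSpace ℝ (Fin n) := fun i => (run x₀ σ π).rate i
  have hr : ∀ i, r i ∈ H.rates (mode (x i)) := fun i => ((run x₀ σ π).rate i).2
  have hsucc : ∀ i, x (i + 1) = x i + t i • r i := (run x₀ σ π).state_succ
  have hsmall : ∀ i j, t i * |l j (r i)| ≤ 1 / (2 * w (x i) ^ 2) := by
    intro i j
    calc t i * |l j (r i)| ≤ t i * B :=
          mul_le_mul_of_nonneg_left (hrates _ _ (hr i) j) (ht0 i)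
      _ = 1 / (2 * w (x i) ^ 2) := by rw [ht, div_mul_cancel₀ _ hB.ne']
  have hinv : ∀ i, (∀ j, l j (x i) ≤ b j) ∧
      activeSet (fun i => l i) b (x i) ⊆ activeSet (fun i => l i) b x₀ := by
    intro i
    induction i with
    | zero => exact ⟨(hS _).1 hx₀, subset_rfl⟩
    | succ i ih =>
      rw [hsucc]
      refine ⟨fun j => ?_, ?_⟩
      · exact step_safe ih.1 (hsmall i)
          ((hmode _ (hopp _ ih.2)).1 _ (hr i)) (ht0 i) le_rfl j
      · exact (step_activeSet_subset ih.1 (ht0 i)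
          (hsmall i)).trans ih.2
  constructor
  · intro i
    refine ⟨(hS _).2 (hinv i).1, fun t' h' => (hS _).2 fun j => ?_⟩
    exact step_safe (hinv i).1 (hsmall i)
      ((hmode _ (hopp _ (hinv i).2)).1 _ (hr i)) h'.1 h'.2 j
  · intro hz
    have hz' : Summable t := NNReal.summable_coe.2 hz
    obtain ⟨N, hN⟩ := eventually_const_of_antitone_finset
      (I := fun i => activeSet (fun i => l i) b (x i)) (fun i => by
        simp only [hsucc]
        exact step_activeSet_subset (hinv i).1 (ht0 i)
          (hsmall i))
    have hw1 : ∀ i, 1 ≤ w (x i) := fun i => one_le_barrier (hinv i).1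
    refine not_summable_of_sq_growth (w := fun i => w (x i)) hB hw1 ht (N := N) ?_ hz'
    intro i hi
    have htpos : 0 < t i := by
      have := hw1 i
      rw [ht]; positivity
    -- A constraint tight at both ends of a move of positive duration is constant along its rate.
    have hI : ∀ j ∈ activeSet (fun i => l i) b (x i), l j (r i) = 0 := by
      intro j hj
      have h1 : l j (x i) = b j := mem_activeSet.1 hj
      have h2 : l j (x (i + 1)) = b j := mem_activeSet.1 (by rw [hN i hi]; exact hj)
      rw [hsucc, map_add, map_smul, smul_eq_mul, h1] at h2
      have h3 : t i * l j (r i) = 0 := by linarith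
      exact (mul_eq_zero.1 h3).resolve_left htpos.ne'
    simp only [hsucc]
    exact step_barrier_le (hinv i).1 (ht0 i) (hsmall i) hI
      ((hmode _ (hopp _ (hinv i).2)).2 _ (hr i) hI)

theorem exists_positional_environment_of_not_canOppose [Finite M] {k : ℕ}
    {l : Fin k → EuclideanSpace ℝ (Fin n) →L[ℝ] ℝ} {b : Fin k → ℝ}
    {S : Set (EuclideanSpace ℝ (Fin n))} (hbdd : Bornology.IsBounded S)
    (hS : ∀ x, x ∈ S ↔ ∀ i, l i x ≤ b i)
    {x₀ : EuclideanSpace ℝ (Fin n)} {I : Finset (Fin k)}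
    (hI : I ⊆ activeSet (fun i => l i) b x₀) (hopp : ¬ H.CanOppose l I) :
    ∃ π : H.EnvironmentStrategy, π.IsPositional ∧ π.IsWinning S x₀ := by
  obtain ⟨v, hv⟩ := not_forall.1 hopp
  have hrate : ∀ m, ∃ r : H.rates m, (∃ i ∈ I, 0 < l i (r : EuclideanSpace ℝ (Fin n))) ∨
      ((∀ i ∈ I, l i (r : EuclideanSpace ℝ (Fin n)) = 0) ∧
        0 < v (r : EuclideanSpace ℝ (Fin n))) := by
    intro m
    by_contra hcon
    push Not at hcon
    refine hv ⟨m, fun r hr i hi => (hcon ⟨r, hr⟩).1 i hi, fun r hr h0 => (hcon ⟨r, hr⟩).2 h0⟩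
  choose rate hrate using hrate
  -- A uniform speed exists because there are finitely many modes.
  obtain ⟨ε, hε, hεle⟩ : ∃ ε : ℝ, 0 < ε ∧
      ∀ m, 0 < v (rate m : EuclideanSpace ℝ (Fin n)) → ε ≤ v (rate m : EuclideanSpace ℝ (Fin n)) := by
    have hev : ∀ᶠ ε : ℝ in nhdsWithin 0 (Set.Ioi 0), ∀ m,
        0 < v (rate m : EuclideanSpace ℝ (Fin n)) → ε ≤ v (rate m : EuclideanSpace ℝ (Fin n)) := by
      rw [Filter.eventually_all]
      intro m
      by_cases hm : 0 < v (rate m : EuclideanSpace ℝ (Fin n))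
      · filter_upwards [nhdsWithin_le_nhds (Iic_mem_nhds hm)] with ε h _ using h
      · exact Filter.Eventually.of_forall fun _ h => absurd h hm
    obtain ⟨ε, h1, h2⟩ := (hev.and self_mem_nhdsWithin).exists
    exact ⟨ε, h2, h1⟩
  obtain ⟨C, hC⟩ := hbdd.exists_norm_le
  refine ⟨fun _ a => rate a.1, fun _ _ _ _ => rfl, fun σ hwin => ?_⟩
  obtain ⟨hsafe, hnz⟩ := hwin
  set ρ := run x₀ σ (fun _ a => rate a.1 : H.EnvironmentStrategy) with hρ
  have hsucc : ∀ i, ρ.state (i + 1) = ρ.state i + ((ρ.move i).2 : ℝ) •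
      (rate (ρ.move i).1 : EuclideanSpace ℝ (Fin n)) := ρ.state_succ
  have hle : ∀ i j, l j (ρ.state i) ≤ b j := fun i => (hS _).1 (hsafe i).1
  have hstep : ∀ i, (∀ j ∈ I, l j (ρ.state i) = b j) →
      ((ρ.move i).2 : ℝ) = 0 ∨
      ((∀ j ∈ I, l j (rate (ρ.move i).1 : EuclideanSpace ℝ (Fin n)) = 0) ∧
        ε ≤ v (rate (ρ.move i).1 : EuclideanSpace ℝ (Fin n))) := by
    intro i hi
    rcases hrate (ρ.move i).1 with ⟨j, hj, hpos⟩ | ⟨h0, hpos⟩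
    -- A positive duration would break a tight constraint, so a safe run can use such a mode only
    -- with duration zero.
    · left
      have h := hle (i + 1) j
      rw [hsucc, map_add, map_smul, smul_eq_mul, hi j hj] at h
      by_contra hne
      have := mul_pos (lt_of_le_of_ne (NNReal.coe_nonneg (ρ.move i).2) (Ne.symm hne)) hpos
      linarith
    · exact Or.inr ⟨h0, hεle _ hpos⟩
  have hact : ∀ i, ∀ j ∈ I, l j (ρ.state i) = b j := by
    intro i
    induction i with
    | zero => exact fun j hj => mem_activeSet.1 (hI hj)
    | succ i ih =>
      intro j hj
      rw [hsucc, map_add, map_smul, smul_eq_mul, ih j hj]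
      rcases hstep i ih with h | h
      · rw [h]; ring
      · rw [h.1 j hj]; ring
  have hprog : ∀ i, ε * ∑ j ∈ Finset.range i, ((ρ.move j).2 : ℝ) ≤
      v (ρ.state i) - v x₀ := by
    intro i
    induction i with
    | zero => simp [hρ, run, history, FiniteRun.last]
    | succ i ih =>
      rw [Finset.sum_range_succ, hsucc, map_add, map_smul, smul_eq_mul, mul_add]
      rcases hstep i (hact i) with h | h
      · rw [h]; linarith
      · have := mul_le_mul_of_nonneg_left h.2 (NNReal.coe_nonneg (ρ.move i).2)
        linarith
  refine hnz (NNReal.summable_coe.1 ?_)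
  refine summable_of_sum_range_le (c := (‖v‖ * C - v x₀) / ε) (fun _ => NNReal.coe_nonneg _)
    fun i => ?_
  rw [le_div_iff₀ hε, mul_comm]
  refine (hprog i).trans (sub_le_sub_right ?_ _)
  exact (le_abs_self _).trans ((v.le_opNorm _).trans
    (mul_le_mul_of_nonneg_left (hC _ (hsafe i).1) (norm_nonneg _)))

end Game

end MultiModeSystem

theorem IsConvexPolytope.exists_continuousLinearMap {n : ℕ}
    {P : Set (EuclideanSpace ℝ (Fin n))} (hP : IsConvexPolytope P) :
    ∃ (k : ℕ) (l : Fin k → EuclideanSpace ℝ (Fin n) →L[ℝ] ℝ) (b : Fin k → ℝ),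
      ∀ x, x ∈ P ↔ ∀ i, l i x ≤ b i := by
  obtain ⟨-, k, A, b, h⟩ := hP
  refine ⟨k, fun i => LinearMap.toContinuousLinearMap
    (LinearMap.proj i ∘ₗ A.mulVecLin ∘ₗ (WithLp.linearEquiv 2 ℝ (Fin n → ℝ)).toLinearMap), b,
    fun x => (h x).trans ?_⟩
  simp [Pi.le_def]

theorem MultiModeSystem.IsBoundedRate.exists_abs_le {M : Type*} [Finite M] {n k : ℕ}
    {H : MultiModeSystem M n} (hH : H.IsBoundedRate)
    (l : Fin k → EuclideanSpace ℝ (Fin n) →L[ℝ] ℝ) :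
    ∃ B : ℝ, 0 < B ∧ ∀ m, ∀ r ∈ H.rates m, ∀ i, |l i r| ≤ B := by
  have hb : Bornology.IsBounded (⋃ m, H.rates m) :=
    Bornology.isBounded_iUnion.2 fun m => (hH m).1
  obtain ⟨C, hC0, hC⟩ := hb.exists_pos_norm_le
  refine ⟨(1 + ∑ i, ‖l i‖) * C, by positivity, fun m r hr i => ?_⟩
  refine ((l i).le_opNorm r).trans (mul_le_mul ?_ (hC r (Set.mem_iUnion.2 ⟨m, hr⟩))
    (norm_nonneg _) (by positivity))
  have := Finset.single_le_sum (f := fun j => ‖l j‖) (fun j _ => norm_nonneg _)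
    (Finset.mem_univ i)
  linarith

theorem MultiModeSystem.exists_positional_winning {M : Type*} [Finite M] [Nonempty M] {n : ℕ}
    (H : MultiModeSystem M n) (hH : H.IsBoundedRate)
    (S : Set (EuclideanSpace ℝ (Fin n))) (hS : IsConvexPolytope S)
    (x₀ : EuclideanSpace ℝ (Fin n)) :
    (∃ σ : H.SchedulerStrategy, σ.IsPositional ∧ σ.IsWinning S x₀) ∨
      ∃ π : H.EnvironmentStrategy, π.IsPositional ∧ π.IsWinning S x₀ := by
  by_cases hne : ∀ m, Nonempty (H.rates m)
  · by_cases hx₀ : x₀ ∈ S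
    · obtain ⟨k, l, b, hl⟩ := hS.exists_continuousLinearMap
      obtain ⟨B, hB, hrates⟩ := hH.exists_abs_le l
      by_cases hopp : ∀ I ⊆ activeSet (fun i => l i) b x₀, H.CanOppose l I
      · exact Or.inl (exists_positional_scheduler_of_canOppose hB hrates hl hx₀ hopp)
      · push Not at hopp
        obtain ⟨I, hI, hno⟩ := hopp
        exact Or.inr (exists_positional_environment_of_not_canOppose hS.1 hl hI hno)
    · exact Or.inr ⟨fun _ a => (hne a.1).some, fun _ _ _ _ => rfl,
        fun σ hwin => hx₀ (hwin.1 0).1⟩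
  -- If some mode has no rates, the environment has no strategy at all and the scheduler wins
  -- vacuously, even from outside `S`.
  · obtain ⟨m, hm⟩ := not_forall.1 hne
    exact Or.inl ⟨fun _ => (m, 0), fun _ _ _ => rfl,
      fun π => absurd ⟨π (.start x₀) (m, 0)⟩ hm⟩

theorem mainTheorem3 {M : Type*} [Finite M] [Nonempty M] {n : ℕ}
    (H : MultiModeSystem M n) (hH : H.IsBoundedRate)
    (S : Set (EuclideanSpace ℝ (Fin n))) (hS : IsConvexPolytope S)
    (x₀ : EuclideanSpace ℝ (Fin n)) :
    ((H.SchedulerWins S x₀ ∧ ¬ H.EnvironmentWins S x₀) ∨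
      (H.EnvironmentWins S x₀ ∧ ¬ H.SchedulerWins S x₀)) ∧
    (H.SchedulerWins S x₀ →
      ∃ σ : H.SchedulerStrategy, σ.IsPositional ∧ σ.IsWinning S x₀) ∧
    (H.EnvironmentWins S x₀ →
      ∃ π : H.EnvironmentStrategy, π.IsPositional ∧ π.IsWinning S x₀) := by
  have hexcl : H.SchedulerWins S x₀ → ¬ H.EnvironmentWins S x₀ :=
    fun ⟨σ, hσ⟩ ⟨π, hπ⟩ => hπ σ (hσ π)
  rcases H.exists_positional_winning hH S hS x₀ with ⟨σ, hp, hw⟩ | ⟨π, hp, hw⟩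
  · have hs : H.SchedulerWins S x₀ := ⟨σ, hw⟩
    exact ⟨Or.inl ⟨hs, hexcl hs⟩, fun _ => ⟨σ, hp, hw⟩, fun he => absurd he (hexcl hs)⟩
  · have he : H.EnvironmentWins S x₀ := ⟨π, hw⟩
    exact ⟨Or.inr ⟨he, fun hs => hexcl hs he⟩, fun hs => absurd he (hexcl hs),
      fun _ => ⟨π, hp, hw⟩⟩
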